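/- **Theorem (dual Fundamental Theorem of Hopf modules).** A *duoidal category* is a category $\mathcal M$ with two monoidal structures $(\circ, I)$ and $(\bullet, J)$, morphisms $\delta: I\to I\bullet I$, $\varpi: J\circ J\to J$, $\tau: I\to J$ and a natural interchange morphism $$\zeta_{A,B,C,D}: (A\bullet B)\circ (C\bullet D)\to (A\circ C)\bullet (B\circ D),$$ such that $(J,\varpi,\tau)$ is a monoid in $(\mathcal M,\circ,I)$, $(I,\delta,\tau)$ is a comonoid in $(\mathcal M,\bullet,J)$, and $\zeta$ satisfies the usual two associativity axioms (one for each of $\circ$ and $\bullet$) and four unitality axioms (left and right, with respect to $\delta$ and to $\varpi$). A *bimonoid* is an object $A$ with a monoid structure $(\mu,\eta)$ in $(\mathcal M,\circ,I)$ and a comonoid structure $(\Delta,\varepsilon)$ in $(\mathcal M,\bullet,J)$ such that $$\Delta\mu=(\mu\bullet\mu)\,\zeta\,(\Delta\circ\Delta),\qquad \varepsilon\mu=\varpi(\varepsilon\circ\varepsilon),\qquad \Delta\eta=(\eta\bullet\eta)\delta,\qquad \varepsilon\eta=\tau .$$ Write $\mathcal M_J$ for the category of right modules over the monoid $J$ in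 $(\mathcal M,\circ,I)$, with forgetful functor $U_J:\mathcal M_J\to\mathcal M$. Write $\mathcal M^I$ and $\mathcal M^A$ for the categories of right comodules over the comonoids $I$ and $A$ in $(\mathcal M,\bullet,J)$. Write $\mathcal M^A_A$ for the category of $A$-Hopf modules: triples $(X,\gamma: X\circ A\to X,\rho: X\to X\bullet A)$ of an object with a right $A$-action and a right $A$-coaction such that $\rho\gamma=(\gamma\bullet\mu)\,\zeta\,(\rho\circ\Delta)$, with the morphisms that respect both. The functor $(-)\bullet I:\mathcal M\to\mathcal M^I$ sends $M$ to $M\bullet I$ with the coaction induced by $\delta$. Let $\mathcal M$ be a duoidal category in which idempotent morphisms split and such that the functor $$G:=\big(\mathcal M_J\xrightarrow{\,U_J\,}\mathcal M\xrightarrow{(-)\bullet I}\mathcal M^I\big)$$ is fully faithful. Then for any bimonoid $A$ in $\mathcal M$ the following assertions are equivalent. (i) For every right $A$-comodule $(Q,\rho)$, the morphism $$\varsigma_Q: Q\circ A\xrightarrow{\rho\circ A}(Q\bullet A)\circ A\cong(Q\bullet A)\circ(J\bullet A)\xrightarrow{\ \zeta\ }(Q\circ J)\bullet(A\circ A)\xrightarrow{(Q\circ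 J)\bullet\mu}(Q\circ J)\bullet A$$ is an isomorphism. (ii) The comparison functor $(-)\bullet A:\mathcal M_J\to\mathcal M^A_A$ is an equivalence of categories. Here, for a $J$-module $(P,\gamma)$, the coaction on $P\bullet A$ is $P\bullet A\xrightarrow{P\bullet\Delta}P\bullet(A\bullet A)\cong(P\bullet A)\bullet A$, and the action is $$(P\bullet A)\circ A\cong(P\bullet A)\circ(J\bullet A)\xrightarrow{\ \zeta\ }(P\circ J)\bullet(A\circ A)\xrightarrow{\gamma\bullet\mu}P\bullet A .$$ -/

import Mathlib

open CategoryTheory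

universe v u

section Modules

open MonoidalCategory

variable {C : Type u} [Category.{v} C] {mc : MonoidalCategory C}

/-- An (associative and unital) right action of a monoid `A` on an object `X` of a monoidal
category. -/
@[ext]
structure RightAction {A : C} (a : MonObj A) (X : C) where
  act : X ⊗ A ⟶ X
  act_one : X ◁ MonObj.one ≫ act = (ρ_ X).hom
  act_mul : X ◁ MonObj.mul ≫ act = (α_ X A A).inv ≫ act ▷ A ≫ act

/-- A (coassociative and counital) right coaction of a comonoid `A` on an object `X` of a
monoidal category. -/
@[ext]
structure RightCoaction {A : C} (a : ComonObj A) (X : C) where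
  coact : X ⟶ X ⊗ A
  coact_counit : coact ≫ X ◁ ComonObj.counit = (ρ_ X).inv
  coact_comul : coact ≫ X ◁ ComonObj.comul = coact ≫ coact ▷ A ≫ (α_ X A A).hom

/-- Right modules over a monoid in a monoidal category. -/
structure RightMod {A : C} (a : MonObj A) where
  X : C
  str : RightAction a X

/-- Right comodules over a comonoid in a monoidal category. -/
structure RightComod {A : C} (a : ComonObj A) where
  X : C
  str : RightCoaction a X

namespace RightMod

variable {A : C} {a : MonObj A}

/-- Morphisms of right modules. -/
@[ext]
structure Hom (P Q : RightMod a) where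
  hom : P.X ⟶ Q.X
  comm : P.str.act ≫ hom = hom ▷ A ≫ Q.str.act

instance : Category (RightMod a) where
  Hom := Hom
  id P := ⟨𝟙 P.X, by simp⟩
  comp f g := ⟨f.hom ≫ g.hom, by
    rw [← Category.assoc, f.comm, Category.assoc, g.comm, comp_whiskerRight, Category.assoc]⟩
  id_comp f := Hom.ext (Category.id_comp _)
  comp_id f := Hom.ext (Category.comp_id _)
  assoc f g h := Hom.ext (Category.assoc _ _ _)

variable (a) in
/-- The forgetful functor from right modules. -/
@[simps]
def forget : RightMod a ⥤ C where
  obj P := P.X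
  map f := f.hom
  map_id _ := rfl
  map_comp _ _ := rfl

end RightMod

namespace RightComod

variable {A : C} {a : ComonObj A}

/-- Morphisms of right comodules. -/
@[ext]
structure Hom (P Q : RightComod a) where
  hom : P.X ⟶ Q.X
  comm : P.str.coact ≫ hom ▷ A = hom ≫ Q.str.coact

instance : Category (RightComod a) where
  Hom := Hom
  id P := ⟨𝟙 P.X, by simp⟩
  comp f g := ⟨f.hom ≫ g.hom, by
    rw [Category.assoc, ← g.comm, ← Category.assoc, ← f.comm, comp_whiskerRight,
      Category.assoc]⟩
  id_comp f := Hom.ext (Category.id_comp _)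
  comp_id f := Hom.ext (Category.comp_id _)
  assoc f g h := Hom.ext (Category.assoc _ _ _)

end RightComod

/-- The coaction `X ⊗ Δ` (up to the associator) of a comonoid `A` on `X ⊗ A`. -/
@[simps]
def cofreeCoaction {A : C} (a : ComonObj A) (X : C) : RightCoaction a (X ⊗ A) where
  coact := X ◁ ComonObj.comul ≫ (α_ X A A).inv
  coact_counit := by
    rw [Category.assoc, ← associator_inv_naturality_right, ← whiskerLeft_comp_assoc,
      ComonObj.comul_counit]
    simp
  coact_comul := by
    have h := ComonObj.comul_assoc A
    simp only [Category.assoc]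
    rw [← associator_inv_naturality_right, ← whiskerLeft_comp_assoc, h]
    simp

/-- The functor `(-) ⊗ A` from the base category to the right comodules over a comonoid `A`,
that is, the right adjoint of the forgetful functor. -/
@[simps]
def cofreeComod {A : C} (a : ComonObj A) : C ⥤ RightComod a where
  obj X := ⟨X ⊗ A, cofreeCoaction a X⟩
  map f := ⟨f ▷ A, by
    simp only [cofreeCoaction_coact, Category.assoc, whisker_exchange_assoc,
      ← associator_inv_naturality_left]⟩
  map_id X := RightComod.Hom.ext (id_whiskerRight _ _)
  map_comp f g := RightComod.Hom.ext (comp_whiskerRight _ _ _)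

end Modules

/-- Two monoidal structures on the same category: `circ` is `(∘, I)`, `bul` is `(•, J)`. -/
class TwoMonoidal (M : Type u) [Category.{v} M] where
  circ : MonoidalCategory M
  bul : MonoidalCategory M

section Notations

/- The subscript `ₒ` refers to the monoidal structure `∘`, the subscript `ᵦ` to `•`. -/

notation:70 X:70 " ⊗ₒ " Y:71 =>
  @MonoidalCategoryStruct.tensorObj _ _ (@MonoidalCategory.toMonoidalCategoryStruct _ _
    TwoMonoidal.circ) X Y
notation:70 X:70 " ⊗ᵦ " Y:71 =>
  @MonoidalCategoryStruct.tensorObj _ _ (@MonoidalCategory.toMonoidalCategoryStruct _ _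
    TwoMonoidal.bul) X Y
notation:70 f:70 " ⊠ₒ " g:71 =>
  @MonoidalCategoryStruct.tensorHom _ _ (@MonoidalCategory.toMonoidalCategoryStruct _ _
    TwoMonoidal.circ) _ _ _ _ f g
notation:70 f:70 " ⊠ᵦ " g:71 =>
  @MonoidalCategoryStruct.tensorHom _ _ (@MonoidalCategory.toMonoidalCategoryStruct _ _
    TwoMonoidal.bul) _ _ _ _ f g
notation:81 X:81 " ◁ₒ " f:82 =>
  @MonoidalCategoryStruct.whiskerLeft _ _ (@MonoidalCategory.toMonoidalCategoryStruct _ _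
    TwoMonoidal.circ) X _ _ f
notation:81 X:81 " ◁ᵦ " f:82 =>
  @MonoidalCategoryStruct.whiskerLeft _ _ (@MonoidalCategory.toMonoidalCategoryStruct _ _
    TwoMonoidal.bul) X _ _ f
notation:81 f:81 " ▷ₒ " X:82 =>
  @MonoidalCategoryStruct.whiskerRight _ _ (@MonoidalCategory.toMonoidalCategoryStruct _ _
    TwoMonoidal.circ) _ _ f X
notation:81 f:81 " ▷ᵦ " X:82 =>
  @MonoidalCategoryStruct.whiskerRight _ _ (@MonoidalCategory.toMonoidalCategoryStruct _ _
    TwoMonoidal.bul) _ _ f X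
notation "αₒ" =>
  @MonoidalCategoryStruct.associator _ _ (@MonoidalCategory.toMonoidalCategoryStruct _ _
    TwoMonoidal.circ)
notation "αᵦ" =>
  @MonoidalCategoryStruct.associator _ _ (@MonoidalCategory.toMonoidalCategoryStruct _ _
    TwoMonoidal.bul)
notation "lₒ" =>
  @MonoidalCategoryStruct.leftUnitor _ _ (@MonoidalCategory.toMonoidalCategoryStruct _ _
    TwoMonoidal.circ)
notation "lᵦ" =>
  @MonoidalCategoryStruct.leftUnitor _ _ (@MonoidalCategory.toMonoidalCategoryStruct _ _
    TwoMonoidal.bul)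
notation "rₒ" =>
  @MonoidalCategoryStruct.rightUnitor _ _ (@MonoidalCategory.toMonoidalCategoryStruct _ _
    TwoMonoidal.circ)
notation "rᵦ" =>
  @MonoidalCategoryStruct.rightUnitor _ _ (@MonoidalCategory.toMonoidalCategoryStruct _ _
    TwoMonoidal.bul)

end Notations

/-- The unit `I` of the monoidal product `∘`. -/
abbrev unitI (M : Type u) [Category.{v} M] [TwoMonoidal M] : M :=
  @MonoidalCategoryStruct.tensorUnit M _ (@MonoidalCategory.toMonoidalCategoryStruct M _
    TwoMonoidal.circ)

/-- The unit `J` of the monoidal product `•`. -/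
abbrev unitJ (M : Type u) [Category.{v} M] [TwoMonoidal M] : M :=
  @MonoidalCategoryStruct.tensorUnit M _ (@MonoidalCategory.toMonoidalCategoryStruct M _
    TwoMonoidal.bul)

/-- Monoids in `(M, ∘, I)`. -/
abbrev CircMon {M : Type u} [Category.{v} M] [TwoMonoidal M] (X : M) :=
  @MonObj M _ TwoMonoidal.circ X

/-- Comonoids in `(M, •, J)`. -/
abbrev BulComon {M : Type u} [Category.{v} M] [TwoMonoidal M] (X : M) :=
  @ComonObj M _ TwoMonoidal.bul X

/-- Multiplication of a monoid in `(M, ∘, I)`. -/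
abbrev CircMon.mul {M : Type u} [Category.{v} M] [TwoMonoidal M] {X : M} (h : CircMon X) :
    X ⊗ₒ X ⟶ X := @MonObj.mul M _ TwoMonoidal.circ X h

/-- Unit of a monoid in `(M, ∘, I)`. -/
abbrev CircMon.one {M : Type u} [Category.{v} M] [TwoMonoidal M] {X : M} (h : CircMon X) :
    unitI M ⟶ X := @MonObj.one M _ TwoMonoidal.circ X h

/-- Comultiplication of a comonoid in `(M, •, J)`. -/
abbrev BulComon.comul {M : Type u} [Category.{v} M] [TwoMonoidal M] {X : M} (h : BulComon X) :
    X ⟶ X ⊗ᵦ X := @ComonObj.comul M _ TwoMonoidal.bul X h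

/-- Counit of a comonoid in `(M, •, J)`. -/
abbrev BulComon.counit {M : Type u} [Category.{v} M] [TwoMonoidal M] {X : M} (h : BulComon X) :
    X ⟶ unitJ M := @ComonObj.counit M _ TwoMonoidal.bul X h

/-- Duoidal categories. The comonoid structure `(δ, τ)` on `I` is `comonI`, the monoid structure
`(ϖ, τ)` on `J` is `monJ`. -/
class Duoidal (M : Type u) [Category.{v} M] extends TwoMonoidal M where
  monJ : CircMon (unitJ M)
  comonI : BulComon (unitI M)
  /-- the unit of `J` and the counit of `I` are the same morphism `τ : I ⟶ J` -/
  one_monJ : CircMon.one monJ = BulComon.counit comonI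
  /-- the interchange law -/
  ζ (A B C D : M) : (A ⊗ᵦ B) ⊗ₒ (C ⊗ᵦ D) ⟶ (A ⊗ₒ C) ⊗ᵦ (B ⊗ₒ D)
  ζ_naturality {A A' B B' C C' D D' : M} (f : A ⟶ A') (g : B ⟶ B') (h : C ⟶ C') (k : D ⟶ D') :
    ((f ⊠ᵦ g) ⊠ₒ (h ⊠ᵦ k)) ≫ ζ A' B' C' D' = ζ A B C D ≫ ((f ⊠ₒ h) ⊠ᵦ (g ⊠ₒ k))
  ζ_assoc_circ (A B C D E F : M) :
    ζ A B C D ▷ₒ (E ⊗ᵦ F) ≫ ζ (A ⊗ₒ C) (B ⊗ₒ D) E F ≫ ((αₒ A C E).hom ⊠ᵦ (αₒ B D F).hom) =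
      (αₒ (A ⊗ᵦ B) (C ⊗ᵦ D) (E ⊗ᵦ F)).hom ≫ (A ⊗ᵦ B) ◁ₒ ζ C D E F ≫
        ζ A B (C ⊗ₒ E) (D ⊗ₒ F)
  ζ_assoc_bul (A B C D E F : M) :
    ζ (A ⊗ᵦ B) C (D ⊗ᵦ E) F ≫ ζ A B D E ▷ᵦ (C ⊗ₒ F) ≫
        (αᵦ (A ⊗ₒ D) (B ⊗ₒ E) (C ⊗ₒ F)).hom =
      ((αᵦ A B C).hom ⊠ₒ (αᵦ D E F).hom) ≫ ζ A (B ⊗ᵦ C) D (E ⊗ᵦ F) ≫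
        (A ⊗ₒ D) ◁ᵦ ζ B C E F
  ζ_unit_left_circ (A B : M) :
    (BulComon.comul comonI) ▷ₒ (A ⊗ᵦ B) ≫ ζ (unitI M) (unitI M) A B ≫ ((lₒ A).hom ⊠ᵦ (lₒ B).hom) =
      (lₒ (A ⊗ᵦ B)).hom
  ζ_unit_right_circ (A B : M) :
    (A ⊗ᵦ B) ◁ₒ (BulComon.comul comonI) ≫ ζ A B (unitI M) (unitI M) ≫ ((rₒ A).hom ⊠ᵦ (rₒ B).hom) =
      (rₒ (A ⊗ᵦ B)).hom
  ζ_unit_left_bul (A B : M) :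
    ζ (unitJ M) A (unitJ M) B ≫ (CircMon.mul monJ) ▷ᵦ (A ⊗ₒ B) ≫ (lᵦ (A ⊗ₒ B)).hom =
      (lᵦ A).hom ⊠ₒ (lᵦ B).hom
  ζ_unit_right_bul (A B : M) :
    ζ A (unitJ M) B (unitJ M) ≫ (A ⊗ₒ B) ◁ᵦ (CircMon.mul monJ) ≫ (rᵦ (A ⊗ₒ B)).hom =
      (rᵦ A).hom ⊠ₒ (rᵦ B).hom

namespace Duoidal

variable (M : Type u) [Category.{v} M] [Duoidal M]

/-- The morphism `τ : I ⟶ J`. -/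
abbrev τ : unitI M ⟶ unitJ M := BulComon.counit (comonI (M := M))

/-- Bimonoids in a duoidal category. -/
structure Bimonoid where
  X : M
  mon : CircMon X
  comon : BulComon X
  mul_comul : mon.mul ≫ comon.comul =
    (comon.comul ⊠ₒ comon.comul) ≫ ζ X X X X ≫ (mon.mul ⊠ᵦ mon.mul)
  mul_counit : mon.mul ≫ comon.counit = (comon.counit ⊠ₒ comon.counit) ≫ CircMon.mul (monJ (M := M))
  one_comul : mon.one ≫ comon.comul = BulComon.comul (comonI (M := M)) ≫ (mon.one ⊠ᵦ mon.one)
  one_counit : mon.one ≫ comon.counit = τ M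

variable {M} in
/-- The multiplication of a bimonoid. -/
abbrev Bimonoid.μ (A : Bimonoid M) : A.X ⊗ₒ A.X ⟶ A.X := CircMon.mul A.mon

variable {M} in
/-- The unit of a bimonoid. -/
abbrev Bimonoid.η (A : Bimonoid M) : unitI M ⟶ A.X := CircMon.one A.mon

variable {M} in
/-- The comultiplication of a bimonoid. -/
abbrev Bimonoid.Δ (A : Bimonoid M) : A.X ⟶ A.X ⊗ᵦ A.X := BulComon.comul A.comon

variable {M} in
/-- The counit of a bimonoid. -/
abbrev Bimonoid.ε (A : Bimonoid M) : A.X ⟶ unitJ M := BulComon.counit A.comon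

/-- The category `M_J` of right modules over the monoid `J` in `(M, ∘, I)`. -/
abbrev ModJ := RightMod (monJ (M := M))

/-- The category `M^I` of right comodules over the comonoid `I` in `(M, •, J)`. -/
abbrev ComodI := RightComod (comonI (M := M))

/-- The functor `G = (-) • I ∘ U_J : M_J ⥤ M^I`. -/
def functorG : ModJ M ⥤ ComodI M :=
  RightMod.forget (monJ (M := M)) ⋙
    cofreeComod (comonI (M := M))

variable {M}

/-- The actions of the monoid underlying a bimonoid `A`, with respect to `∘`. -/
abbrev Action (A : Bimonoid M) (X : M) := RightAction A.mon X

/-- The coactions of the comonoid underlying a bimonoid `A`, with respect to `•`. -/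
abbrev Coaction (A : Bimonoid M) (X : M) := RightCoaction A.comon X

/-- The category `M^A` of right comodules over the comonoid underlying `A` in `(M, •, J)`. -/
abbrev Comod (A : Bimonoid M) := RightComod A.comon

/-- (Right-right) Hopf modules over a bimonoid `A`. -/
structure HopfModule (A : Bimonoid M) where
  X : M
  action : Action A X
  coaction : Coaction A X
  compat : action.act ≫ coaction.coact =
    (coaction.coact ⊠ₒ A.Δ) ≫ ζ X A.X A.X A.X ≫ (action.act ⊠ᵦ A.μ)

namespace HopfModule

variable {A : Bimonoid M}

/-- Morphisms of Hopf modules: the morphisms of both modules and comodules. -/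
@[ext]
structure Hom (P Q : HopfModule A) where
  hom : P.X ⟶ Q.X
  comm_act : P.action.act ≫ hom = hom ▷ₒ A.X ≫ Q.action.act
  comm_coact : P.coaction.coact ≫ hom ▷ᵦ A.X = hom ≫ Q.coaction.coact

/-- The category `M^A_A` of Hopf modules. -/
instance : Category (HopfModule A) where
  Hom := Hom
  id P := ⟨𝟙 P.X, by
    rw [@MonoidalCategory.id_whiskerRight M _ TwoMonoidal.circ, Category.id_comp,
      Category.comp_id], by
    rw [@MonoidalCategory.id_whiskerRight M _ TwoMonoidal.bul, Category.id_comp,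
      Category.comp_id]⟩
  comp f g := ⟨f.hom ≫ g.hom, by
    rw [← Category.assoc, f.comm_act, Category.assoc, g.comm_act,
      @MonoidalCategory.comp_whiskerRight M _ TwoMonoidal.circ, Category.assoc], by
    rw [Category.assoc, ← g.comm_coact, ← Category.assoc, ← f.comm_coact,
      @MonoidalCategory.comp_whiskerRight M _ TwoMonoidal.bul, Category.assoc]⟩
  id_comp f := Hom.ext (Category.id_comp _)
  comp_id f := Hom.ext (Category.comp_id _)
  assoc f g h := Hom.ext (Category.assoc _ _ _)

end HopfModule

section Lemmas

/- Laws of the two monoidal structures, in the form used below. -/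

lemma circ_comp {X₁ Y₁ Z₁ X₂ Y₂ Z₂ : M} (f₁ : X₁ ⟶ Y₁) (g₁ : Y₁ ⟶ Z₁) (f₂ : X₂ ⟶ Y₂)
    (g₂ : Y₂ ⟶ Z₂) : (f₁ ⊠ₒ f₂) ≫ (g₁ ⊠ₒ g₂) = (f₁ ≫ g₁) ⊠ₒ (f₂ ≫ g₂) :=
  @MonoidalCategory.tensorHom_comp_tensorHom M _ TwoMonoidal.circ _ _ _ _ _ _ f₁ f₂ g₁ g₂

lemma bul_comp {X₁ Y₁ Z₁ X₂ Y₂ Z₂ : M} (f₁ : X₁ ⟶ Y₁) (g₁ : Y₁ ⟶ Z₁) (f₂ : X₂ ⟶ Y₂)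
    (g₂ : Y₂ ⟶ Z₂) : (f₁ ⊠ᵦ f₂) ≫ (g₁ ⊠ᵦ g₂) = (f₁ ≫ g₁) ⊠ᵦ (f₂ ≫ g₂) :=
  @MonoidalCategory.tensorHom_comp_tensorHom M _ TwoMonoidal.bul _ _ _ _ _ _ f₁ f₂ g₁ g₂

lemma circ_id (X Y : M) : 𝟙 X ⊠ₒ 𝟙 Y = 𝟙 (X ⊗ₒ Y) :=
  @MonoidalCategory.id_tensorHom_id M _ TwoMonoidal.circ X Y

lemma bul_id (X Y : M) : 𝟙 X ⊠ᵦ 𝟙 Y = 𝟙 (X ⊗ᵦ Y) :=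
  @MonoidalCategory.id_tensorHom_id M _ TwoMonoidal.bul X Y

lemma circ_left (X : M) {Y Z : M} (f : Y ⟶ Z) : X ◁ₒ f = 𝟙 X ⊠ₒ f :=
  (@MonoidalCategory.id_tensorHom M _ TwoMonoidal.circ X _ _ f).symm

lemma bul_left (X : M) {Y Z : M} (f : Y ⟶ Z) : X ◁ᵦ f = 𝟙 X ⊠ᵦ f :=
  (@MonoidalCategory.id_tensorHom M _ TwoMonoidal.bul X _ _ f).symm

lemma circ_right (X : M) {Y Z : M} (f : Y ⟶ Z) : f ▷ₒ X = f ⊠ₒ 𝟙 X :=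
  (@MonoidalCategory.tensorHom_id M _ TwoMonoidal.circ _ _ f X).symm

lemma bul_right (X : M) {Y Z : M} (f : Y ⟶ Z) : f ▷ᵦ X = f ⊠ᵦ 𝟙 X :=
  (@MonoidalCategory.tensorHom_id M _ TwoMonoidal.bul _ _ f X).symm

lemma circ_assoc {X X' Y Y' Z Z' : M} (f : X ⟶ X') (g : Y ⟶ Y') (h : Z ⟶ Z') :
    ((f ⊠ₒ g) ⊠ₒ h) ≫ (αₒ X' Y' Z').hom = (αₒ X Y Z).hom ≫ (f ⊠ₒ (g ⊠ₒ h)) :=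
  @MonoidalCategory.associator_naturality M _ TwoMonoidal.circ _ _ _ _ _ _ f g h

lemma bul_assoc {X X' Y Y' Z Z' : M} (f : X ⟶ X') (g : Y ⟶ Y') (h : Z ⟶ Z') :
    ((f ⊠ᵦ g) ⊠ᵦ h) ≫ (αᵦ X' Y' Z').hom = (αᵦ X Y Z).hom ≫ (f ⊠ᵦ (g ⊠ᵦ h)) :=
  @MonoidalCategory.associator_naturality M _ TwoMonoidal.bul _ _ _ _ _ _ f g h

lemma bul_left_nat {X Y : M} (f : X ⟶ Y) : f ≫ (lᵦ Y).inv = (lᵦ X).inv ≫ (𝟙 (unitJ M) ⊠ᵦ f) := by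
  have h := @MonoidalCategory.leftUnitor_inv_naturality M _ TwoMonoidal.bul _ _ f
  rw [bul_left] at h
  exact h

lemma bul_left_tensor (X Y : M) :
    ((lᵦ X).inv ⊠ᵦ 𝟙 Y) ≫ (αᵦ (unitJ M) X Y).hom = (lᵦ (X ⊗ᵦ Y)).inv := by
  rw [← bul_right, @MonoidalCategory.leftUnitor_tensor_inv M _ TwoMonoidal.bul]

/-- The multiplication of `A` is compatible with the canonical isomorphism `A ≅ J • A`. -/
lemma mul_leftUnitor_inv (A : Bimonoid M) :
    A.μ ≫ (lᵦ A.X).inv = ((lᵦ A.X).inv ⊠ₒ (lᵦ A.X).inv) ≫ ζ (unitJ M) A.X (unitJ M) A.X ≫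
      (CircMon.mul (monJ (M := M)) ⊠ᵦ A.μ) := by
  have h : ((lᵦ A.X).inv ⊠ₒ (lᵦ A.X).inv) ≫ ζ (unitJ M) A.X (unitJ M) A.X ≫
      (CircMon.mul (monJ (M := M)) ⊠ᵦ 𝟙 (A.X ⊗ₒ A.X)) = (lᵦ (A.X ⊗ₒ A.X)).inv := by
    rw [← cancel_mono (lᵦ (A.X ⊗ₒ A.X)).hom, Iso.inv_hom_id, Category.assoc, Category.assoc,
      ← bul_right, ζ_unit_left_bul, circ_comp, Iso.inv_hom_id, circ_id]
  rw [bul_left_nat, ← h]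
  simp only [Category.assoc, bul_comp, Category.comp_id, Category.id_comp]

/-- The unit of `A` is compatible with the canonical isomorphism `A ≅ J • A`. -/
lemma one_leftUnitor_inv (A : Bimonoid M) :
    A.η ≫ (lᵦ A.X).inv = BulComon.comul (comonI (M := M)) ≫ (τ M ⊠ᵦ A.η) := by
  rw [bul_left_nat, ← @ComonObj.counit_comul M _ TwoMonoidal.bul (unitI M) comonI, bul_right,
    Category.assoc, bul_comp, Category.comp_id, Category.id_comp]

end Lemmas

/-- The action of `A` on `P • A`, for a `J`-module `P`:
`(P • A) ∘ A ≅ (P • A) ∘ (J • A) ⟶ (P ∘ J) • (A ∘ A) ⟶ P • A`. -/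
def comparisonAct (A : Bimonoid M) (P : ModJ M) : (P.X ⊗ᵦ A.X) ⊗ₒ A.X ⟶ P.X ⊗ᵦ A.X :=
  (P.X ⊗ᵦ A.X) ◁ₒ (lᵦ A.X).inv ≫ ζ P.X A.X (unitJ M) A.X ≫ (P.str.act ⊠ᵦ A.μ)

lemma comparisonAct_one (A : Bimonoid M) (P : ModJ M) :
    (P.X ⊗ᵦ A.X) ◁ₒ A.η ≫ comparisonAct A P = (rₒ (P.X ⊗ᵦ A.X)).hom := by
  have h : (𝟙 P.X ⊠ₒ τ M) ≫ P.str.act = (rₒ P.X).hom := by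
    rw [show τ M = CircMon.one monJ from one_monJ.symm, ← circ_left]
    exact P.str.act_one
  have h' : (𝟙 A.X ⊠ₒ A.η) ≫ A.μ = (rₒ A.X).hom := by
    rw [← circ_left]
    exact @MonObj.mul_one M _ TwoMonoidal.circ A.X A.mon
  unfold comparisonAct
  rw [← ζ_unit_right_circ, ← h, ← h']
  simp only [circ_left]
  rw [← Category.assoc, circ_comp, one_leftUnitor_inv, Category.comp_id,
    ← bul_comp, ← reassoc_of% ζ_naturality, bul_id, ← Category.assoc _ _ (ζ _ _ _ _ ≫ _),
    circ_comp, Category.comp_id]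

lemma comparisonAct_mul (A : Bimonoid M) (P : ModJ M) :
    (P.X ⊗ᵦ A.X) ◁ₒ A.μ ≫ comparisonAct A P =
      (αₒ (P.X ⊗ᵦ A.X) A.X A.X).inv ≫ comparisonAct A P ▷ₒ A.X ≫ comparisonAct A P := by
  have h : (P.str.act ⊠ₒ 𝟙 (unitJ M)) ≫ P.str.act =
      (αₒ P.X (unitJ M) (unitJ M)).hom ≫
        (𝟙 P.X ⊠ₒ CircMon.mul (monJ (M := M))) ≫ P.str.act := by
    rw [← circ_left, P.str.act_mul, Iso.hom_inv_id_assoc, circ_right]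
  have h' : (A.μ ⊠ₒ 𝟙 A.X) ≫ A.μ = (αₒ A.X A.X A.X).hom ≫ (𝟙 A.X ⊠ₒ A.μ) ≫ A.μ := by
    rw [← circ_left, ← circ_right]
    exact @MonObj.mul_assoc M _ TwoMonoidal.circ A.X A.mon
  rw [← cancel_epi (αₒ (P.X ⊗ᵦ A.X) A.X A.X).hom, Iso.hom_inv_id_assoc]
  have key := ζ_assoc_circ P.X A.X (unitJ M) A.X (unitJ M) A.X
  simp only [circ_left, circ_right] at key
  have e : comparisonAct A P ▷ₒ A.X ≫ comparisonAct A P =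
      (((𝟙 (P.X ⊗ᵦ A.X)) ⊠ₒ (lᵦ A.X).inv) ⊠ₒ (lᵦ A.X).inv) ≫
        (ζ P.X A.X (unitJ M) A.X ⊠ₒ 𝟙 _) ≫
        ζ (P.X ⊗ₒ unitJ M) (A.X ⊗ₒ A.X) (unitJ M) A.X ≫
        (((P.str.act ⊠ₒ 𝟙 (unitJ M)) ≫ P.str.act) ⊠ᵦ ((A.μ ⊠ₒ 𝟙 A.X) ≫ A.μ)) := by
    rw [← bul_comp, ← reassoc_of% ζ_naturality, bul_id]
    simp only [comparisonAct, circ_left, circ_right, ← Category.assoc, circ_comp,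
      Category.comp_id, Category.id_comp]
  rw [e, h, h', ← bul_comp, reassoc_of% key, ← Category.assoc (((_ ⊠ₒ _) ⊠ₒ _)), circ_assoc,
    Category.assoc, ← bul_comp, ← reassoc_of% ζ_naturality, bul_id]
  simp only [comparisonAct, circ_left, ← Category.assoc]
  congr 2
  simp only [Category.assoc, circ_comp, Category.comp_id, mul_leftUnitor_inv]

lemma comparisonAct_comul (A : Bimonoid M) (P : ModJ M) :
    comparisonAct A P ≫ (cofreeCoaction A.comon P.X).coact =
      ((cofreeCoaction A.comon P.X).coact ⊠ₒ A.Δ) ≫ ζ (P.X ⊗ᵦ A.X) A.X A.X A.X ≫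
        (comparisonAct A P ⊠ᵦ A.μ) := by
  have h : (A.Δ ≫ ((lᵦ A.X).inv ⊠ᵦ 𝟙 A.X)) ≫ (αᵦ (unitJ M) A.X A.X).hom =
      (lᵦ A.X).inv ≫ (𝟙 (unitJ M) ⊠ᵦ A.Δ) := by
    rw [Category.assoc, bul_left_tensor, bul_left_nat]
  have key := ζ_assoc_bul P.X A.X A.X (unitJ M) A.X A.X
  simp only [bul_left, bul_right] at key
  rw [← cancel_mono (αᵦ P.X A.X A.X).hom]
  have e : (comparisonAct A P ⊠ᵦ A.μ) ≫ (αᵦ P.X A.X A.X).hom =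
      ((𝟙 (P.X ⊗ᵦ A.X) ⊠ₒ (lᵦ A.X).inv) ⊠ᵦ (𝟙 A.X ⊠ₒ 𝟙 A.X)) ≫
        (ζ P.X A.X (unitJ M) A.X ⊠ᵦ 𝟙 _) ≫
        (αᵦ (P.X ⊗ₒ unitJ M) (A.X ⊗ₒ A.X) (A.X ⊗ₒ A.X)).hom ≫
        (P.str.act ⊠ᵦ (A.μ ⊠ᵦ A.μ)) := by
    rw [← bul_assoc]
    simp only [comparisonAct, circ_left, ← Category.assoc, bul_comp, circ_id,
      Category.id_comp]
  simp only [Category.assoc]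
  rw [e, ← reassoc_of% ζ_naturality, bul_id, reassoc_of% key, ← Category.assoc (_ ⊠ₒ _),
    circ_comp, Category.comp_id, ← Category.assoc (_ ⊠ₒ _), circ_comp, h]
  have c : (cofreeCoaction A.comon P.X).coact ≫ (αᵦ P.X A.X A.X).hom = 𝟙 P.X ⊠ᵦ A.Δ := by
    rw [cofreeCoaction_coact, Category.assoc, Iso.inv_hom_id, Category.comp_id]
    exact bul_left _ _
  rw [c, ← Category.id_comp (𝟙 P.X ⊠ᵦ A.Δ), ← circ_comp, Category.assoc,
    reassoc_of% ζ_naturality]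
  simp only [comparisonAct, circ_left, Category.assoc, bul_comp, circ_id,
    Category.id_comp, Category.comp_id]
  rw [A.mul_comul]

lemma comparisonAct_naturality (A : Bimonoid M) {P Q : ModJ M} (f : P ⟶ Q) :
    comparisonAct A P ≫ f.hom ▷ᵦ A.X = (f.hom ▷ᵦ A.X) ▷ₒ A.X ≫ comparisonAct A Q := by
  have h : (f.hom ⊠ₒ 𝟙 (unitJ M)) ≫ Q.str.act = P.str.act ≫ f.hom := by
    rw [f.comm, circ_right]
  have e : ((f.hom ⊠ᵦ 𝟙 A.X) ⊠ₒ 𝟙 A.X) ≫ (𝟙 (Q.X ⊗ᵦ A.X) ⊠ₒ (lᵦ A.X).inv) =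
      (𝟙 (P.X ⊗ᵦ A.X) ⊠ₒ (lᵦ A.X).inv) ≫ ((f.hom ⊠ᵦ 𝟙 A.X) ⊠ₒ (𝟙 (unitJ M) ⊠ᵦ 𝟙 A.X)) := by
    simp only [circ_comp, bul_id, Category.id_comp, Category.comp_id]
  simp only [comparisonAct, circ_left, circ_right, bul_right, Category.assoc]
  rw [reassoc_of% e, reassoc_of% ζ_naturality]
  simp only [bul_comp, circ_id, h, Category.id_comp, Category.comp_id]

/-- The comparison functor `(-) • A : M_J ⥤ M^A_A`. The coaction on `P • A` is the cofree one,
given by the comultiplication of `A`. -/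
def comparison (A : Bimonoid M) : ModJ M ⥤ HopfModule A where
  obj P :=
    { X := P.X ⊗ᵦ A.X
      action := ⟨comparisonAct A P, comparisonAct_one A P, comparisonAct_mul A P⟩
      coaction := cofreeCoaction A.comon P.X
      compat := comparisonAct_comul A P }
  map f := ⟨f.hom ▷ᵦ A.X, comparisonAct_naturality A f,
    ((cofreeComod A.comon).map f.hom).comm⟩
  map_id _ := HopfModule.Hom.ext (@MonoidalCategory.id_whiskerRight M _ TwoMonoidal.bul _ _)
  map_comp _ _ :=
    HopfModule.Hom.ext (@MonoidalCategory.comp_whiskerRight M _ TwoMonoidal.bul _ _ _ _ _ _)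

/-- The morphism `ς_Q : Q ∘ A ⟶ (Q ∘ J) • A` for an `A`-comodule `Q`. -/
def ς (A : Bimonoid M) (Q : Comod A) : Q.X ⊗ₒ A.X ⟶ (Q.X ⊗ₒ unitJ M) ⊗ᵦ A.X :=
  Q.str.coact ▷ₒ A.X ≫ (Q.X ⊗ᵦ A.X) ◁ₒ (lᵦ A.X).inv ≫ ζ Q.X A.X (unitJ M) A.X ≫
    (Q.X ⊗ₒ unitJ M) ◁ᵦ A.μ

end Duoidal

/-! Both assertions concern two left adjoints. Let `U` forget the action from Hopf modules to
`A`-comodules; its left adjoint `F` sends `Q` to `Q ∘ A` with the diagonal coaction. Let `K` be `(-)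
• A` into Hopf modules. Then `K ⋙ U` is the forgetful functor from `J`-modules followed by the
cofree comodule functor, so it has the left adjoint `L`, sending `Q` to `Q ∘ J`. The canonical map
`F Q ⟶ K (L Q)` between the left adjoints has `ς A Q` as underlying morphism
(`leftAdjointComparison_hom`), and the forgetful functors reflect isomorphisms. So (i) says that
this map is invertible for every `Q`.

If `K` is an equivalence, then `F` and `L ⋙ K` are both left adjoint to `U`, whence (i):
`isIso_leftAdjointComparison`.

For the converse, `K ⋙ U` is shown to be separable: its action on morphisms has a natural
retraction. A morphism `P • A ⟶ Q • A` is restricted along the unit and the counit of `A` to `P • I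
⟶ Q`, which by cofreeness is a comodule morphism `P • I ⟶ Q • I`, and full faithfulness of `G` turns
it into a module morphism `P ⟶ Q` (`comparisonHomRetraction`). With such a retraction a Beck-type
argument applies: the `U`-split presentation of a Hopf module lifts to a split coequalizer of
`J`-modules, obtained by splitting an idempotent (`isEquivalence_of_homRetraction`). -/

section Comparison

-- Comparison of the left adjoints of `U` and `K ⋙ U`.

universe v₁ v₂ v₃ u₁ u₂ u₃

variable {B : Type u₁} [Category.{v₁} B] {D : Type u₂} [Category.{v₂} D]
  {H : Type u₃} [Category.{v₃} H] {U : H ⥤ B} {F : B ⥤ H} {K : D ⥤ H} {L : B ⥤ D}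

/-- The canonical comparison `F Q ⟶ K (L Q)` between the left adjoint `F` of `U` and the left
adjoint `L` of `K ⋙ U`. -/
def leftAdjointComparison (adj : F ⊣ U) (adj' : L ⊣ K ⋙ U) (Q : B) :
    F.obj Q ⟶ K.obj (L.obj Q) :=
  (adj.homEquiv Q (K.obj (L.obj Q))).symm (adj'.unit.app Q)

variable (adj : F ⊣ U) (adj' : L ⊣ K ⋙ U)

lemma unit_leftAdjointComparison (Q : B) :
    adj.unit.app Q ≫ U.map (leftAdjointComparison adj adj' Q) = adj'.unit.app Q := by
  exact (adj.homEquiv_unit _ _ _).symm.trans (Equiv.apply_symm_apply _ _)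

lemma leftAdjointComparison_naturality {Q R : B} (h : Q ⟶ R) :
    F.map h ≫ leftAdjointComparison adj adj' R =
      leftAdjointComparison adj adj' Q ≫ K.map (L.map h) := by
  apply (adj.homEquiv _ _).injective
  rw [adj.homEquiv_naturality_left, adj.homEquiv_naturality_right, leftAdjointComparison,
    leftAdjointComparison, Equiv.apply_symm_apply, Equiv.apply_symm_apply]
  exact adj'.unit.naturality h

/-- Both sides have the identity as transpose under `adj`, by the two right triangle identities.
This lets the counit of `adj` at objects `K.obj P` be traded for the image under `K` of the counit
of `adj'`. -/
lemma leftAdjointComparison_counit (P : D) :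
    leftAdjointComparison adj adj' (U.obj (K.obj P)) ≫ K.map (adj'.counit.app P) =
      adj.counit.app (K.obj P) := by
  apply (adj.homEquiv _ _).injective
  rw [adj.homEquiv_naturality_right, leftAdjointComparison, Equiv.apply_symm_apply,
    adj.homEquiv_unit, adj.right_triangle_components]
  exact adj'.right_triangle_components P

/-- If `K` is an equivalence then the two left adjoints agree. -/
lemma isIso_leftAdjointComparison [K.IsEquivalence] (Q : B) :
    IsIso (leftAdjointComparison adj adj' Q) := by
  let P := K.objPreimage (F.obj Q)
  let j : K.obj P ≅ F.obj Q := K.objObjPreimageIso (F.obj Q)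
  -- With `F.obj Q` replaced by an isomorphic `K.obj P`, the unit of `adj` becomes a morphism that
  -- the universal property of `L.obj Q` can receive.
  let m : L.obj Q ⟶ P := (adj'.homEquiv Q P).symm (adj.unit.app Q ≫ U.map j.inv)
  have hm : adj'.unit.app Q ≫ U.map (K.map m) = adj.unit.app Q ≫ U.map j.inv := by
    have := (adj'.homEquiv Q P).apply_symm_apply (adj.unit.app Q ≫ U.map j.inv)
    rwa [adj'.homEquiv_unit] at this
  have h₁ : leftAdjointComparison adj adj' Q ≫ K.map m ≫ j.hom = 𝟙 _ := by
    apply (adj.homEquiv _ _).injective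
    rw [adj.homEquiv_unit, adj.homEquiv_unit, U.map_comp, ← Category.assoc,
      unit_leftAdjointComparison, U.map_comp, reassoc_of% hm, ← U.map_comp, j.inv_hom_id]
  refine ⟨K.map m ≫ j.hom, h₁, ?_⟩
  -- By fullness the other composite is `K.map n`; since `n` fixes the unit of `adj'`, it is the
  -- identity.
  let n : L.obj Q ⟶ L.obj Q :=
    K.preimage ((K.map m ≫ j.hom) ≫ leftAdjointComparison adj adj' Q)
  have hn : K.map n = (K.map m ≫ j.hom) ≫ leftAdjointComparison adj adj' Q := K.map_preimage _
  have : n = 𝟙 _ := by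
    apply (adj'.homEquiv _ _).injective
    rw [adj'.homEquiv_unit, adj'.homEquiv_unit, Functor.comp_map, hn,
      ← unit_leftAdjointComparison adj adj', Category.assoc, ← U.map_comp, ← Category.assoc, h₁,
      Category.id_comp, Functor.comp_map, K.map_id, U.map_id]
    exact (Category.comp_id _).symm
  rw [← hn, this, K.map_id]

/-! ### Separable functors and the Beck-type criterion. -/

/-- A retraction of the action of a functor `V` on morphisms, natural with respect to composition
with morphisms in the image of `V`. -/
structure HomRetraction (V : D ⥤ B) where
  toFun {P Q : D} (t : V.obj P ⟶ V.obj Q) : P ⟶ Q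
  map_comp {P Q R : D} (f : P ⟶ Q) (t : V.obj Q ⟶ V.obj R) :
    toFun (V.map f ≫ t) = f ≫ toFun t
  comp_map {P Q R : D} (t : V.obj P ⟶ V.obj Q) (f : Q ⟶ R) :
    toFun (t ≫ V.map f) = toFun t ≫ f
  map_id (P : D) : toFun (𝟙 (V.obj P)) = 𝟙 P

lemma HomRetraction.map {V : D ⥤ B} (r : HomRetraction V) {P Q : D} (f : P ⟶ Q) :
    r.toFun (V.map f) = f := by
  rw [← Category.comp_id (V.map f), r.map_comp, r.map_id, Category.comp_id]

/-- If the two left adjoints agree, and morphisms can be descended along `K ⋙ U`, then `K` is an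
equivalence. -/
lemma isEquivalence_of_homRetraction [U.Faithful] [U.ReflectsIsomorphisms]
    [IsIdempotentComplete D]
    (r : HomRetraction (K ⋙ U)) [∀ Q, IsIso (leftAdjointComparison adj adj' Q)] :
    K.IsEquivalence := by
  have faithful : K.Faithful := ⟨fun {P Q f g} h => by
    rw [← r.map f, ← r.map g, Functor.comp_map, Functor.comp_map, h]⟩
  have counit_eq {X Y : H} (h : X ⟶ Y) :
      adj.counit.app X ≫ h = F.map (U.map h) ≫ adj.counit.app Y :=
    (adj.counit.naturality h).symm
  have tri (P : D) : adj'.unit.app (U.obj (K.obj P)) ≫ U.map (K.map (adj'.counit.app P)) = 𝟙 _ :=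
    adj'.right_triangle_components P
  have full : K.Full := ⟨fun {P Q} h => by
    -- After precomposition with the invertible comparison this is naturality of the counit of `adj`
    -- at `h`. It puts `K.map (adj'.counit.app P) ≫ h` in the image of `K` before `h` itself is
    -- known to be there.
    have e : K.map (adj'.counit.app P) ≫ h =
        K.map (L.map (U.map h) ≫ adj'.counit.app Q) := by
      rw [← cancel_epi (leftAdjointComparison adj adj' (U.obj (K.obj P))), ← Category.assoc,
        leftAdjointComparison_counit, counit_eq, K.map_comp, ← Category.assoc,
        ← leftAdjointComparison_naturality, Category.assoc, leftAdjointComparison_counit]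
    have e' : adj'.counit.app P ≫ r.toFun (U.map h) = L.map (U.map h) ≫ adj'.counit.app Q := by
      rw [← r.map_comp, Functor.comp_map, ← U.map_comp, e]
      exact r.map _
    refine ⟨r.toFun (U.map h), ?_⟩
    rw [← e', K.map_comp] at e
    -- The counit can be cancelled after applying `U`, where the unit of `adj'` splits it.
    have e'' := congrArg (fun k => adj'.unit.app (U.obj (K.obj P)) ≫ U.map k) e
    simp only [U.map_comp] at e''
    rw [reassoc_of% tri P, reassoc_of% tri P] at e''
    exact U.map_injective e''.symm⟩
  have essSurj : K.EssSurj := ⟨fun X => by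
    let a : K.obj (L.obj (U.obj X)) ⟶ X :=
      inv (leftAdjointComparison adj adj' (U.obj X)) ≫ adj.counit.app X
    let s : U.obj X ⟶ U.obj (K.obj (L.obj (U.obj X))) := adj'.unit.app (U.obj X)
    have sa : s ≫ U.map a = 𝟙 _ := by
      simp only [s, a]
      rw [← unit_leftAdjointComparison adj adj', Category.assoc, ← U.map_comp,
        IsIso.hom_inv_id_assoc, adj.right_triangle_components]
    -- The pair `f`, `g` is the canonical presentation of `X`: its image under `K ⋙ U` is a split
    -- fork over `U.map a`, with splittings `s` and `t`.
    let f := L.map (U.map a)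
    let g := adj'.counit.app (L.obj (U.obj X))
    let t := adj'.unit.app (U.obj (K.obj (L.obj (U.obj X))))
    have fa : K.map f ≫ a = K.map g ≫ a := by
      rw [← cancel_epi (leftAdjointComparison adj adj' _), ← Category.assoc,
        ← leftAdjointComparison_naturality, Category.assoc, IsIso.hom_inv_id_assoc, ← counit_eq]
      simp only [← leftAdjointComparison_counit adj adj', Category.assoc]
      rfl
    have tg : t ≫ (K ⋙ U).map g = 𝟙 _ := tri _
    have tf : t ≫ (K ⋙ U).map f = U.map a ≫ s := (adj'.unit.naturality (U.map a)).symm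
    -- The retraction carries the splitting `t` down to `D`. Naturality of `r` preserves the
    -- identities `tg'` and `ftf`, which make `t' ≫ f` idempotent and its splitting `q` a split
    -- coequalizer of `f` and `g`.
    let t' := r.toFun t
    have tg' : t' ≫ g = 𝟙 _ := by
      rw [← r.comp_map, tg]; exact r.map_id _
    have ftf : f ≫ t' ≫ f = g ≫ t' ≫ f := by
      rw [← r.comp_map, ← r.map_comp, ← r.map_comp, tf, Functor.comp_map, Functor.comp_map,
        ← Category.assoc, ← Category.assoc, ← U.map_comp, ← U.map_comp, fa]
    have idem : (t' ≫ f) ≫ (t' ≫ f) = t' ≫ f := by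
      rw [Category.assoc, ftf, reassoc_of% tg']
    obtain ⟨P, i, q, hiq, hqi⟩ := IsIdempotentComplete.idempotents_split _ _ idem
    have fq : f ≫ q = g ≫ q := by
      rw [← Category.comp_id q, ← hiq, reassoc_of% hqi, reassoc_of% ftf]
    refine ⟨P, ⟨@asIso _ _ _ _ (K.map i ≫ a) ?_⟩⟩
    have : IsIso (U.map (K.map i ≫ a)) := by
      -- `U.map a` and `U.map (K.map q)` are split coequalizers of the same pair, so the induced
      -- morphisms between their targets are mutually inverse.
      refine ⟨s ≫ U.map (K.map q), ?_, ?_⟩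
      · have h : U.map a ≫ s ≫ U.map (K.map q) = U.map (K.map q) := by
          rw [← Category.assoc, ← tf, Category.assoc, Functor.comp_map, ← U.map_comp,
            ← K.map_comp, fq, K.map_comp, U.map_comp]
          exact (Category.assoc _ _ _).symm.trans ((congrArg (· ≫ _) tg).trans (Category.id_comp _))
        rw [U.map_comp, Category.assoc, h, ← U.map_comp, ← K.map_comp, hiq, K.map_id, U.map_id]
      · rw [Category.assoc, ← U.map_comp, ← Category.assoc (K.map q), ← K.map_comp, hqi,
          K.map_comp, Category.assoc, fa, ← Category.assoc, ← K.map_comp, tg', K.map_id,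
          Category.id_comp, sa]
    exact isIso_of_reflects_iso _ U⟩
  exact {}

end Comparison

/-! ### Free modules, cofree comodules, and splitting idempotents of modules. -/

section FreeCofree

open MonoidalCategory

variable {C : Type u} [Category.{v} C] {mc : MonoidalCategory C}

/-- The free action of a monoid `A` on `X ⊗ A`. -/
@[simps]
def freeAction {A : C} (a : MonObj A) (X : C) : RightAction a (X ⊗ A) where
  act := (α_ X A A).hom ≫ X ◁ MonObj.mul
  act_one := by
    rw [associator_naturality_right_assoc, ← whiskerLeft_comp, MonObj.mul_one]
    simp
  act_mul := by
    have h := MonObj.mul_assoc A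
    simp only [comp_whiskerRight, Category.assoc, whisker_assoc, Iso.inv_hom_id_assoc]
    rw [associator_naturality_right_assoc, ← whiskerLeft_comp, ← whiskerLeft_comp,
      ← cancel_epi (α_ (X ⊗ A) A A).hom, Iso.hom_inv_id_assoc,
      ← pentagon_assoc, ← whiskerLeft_comp, h]

/-- The free right module functor. -/
@[simps]
def freeMod {A : C} (a : MonObj A) : C ⥤ RightMod a where
  obj X := ⟨X ⊗ A, freeAction a X⟩
  map f := ⟨f ▷ A, by
    simp only [freeAction_act, Category.assoc, whisker_exchange, associator_naturality_left_assoc]⟩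
  map_id X := RightMod.Hom.ext (id_whiskerRight _ _)
  map_comp f g := RightMod.Hom.ext (comp_whiskerRight _ _ _)

/-- The free module functor is left adjoint to the forgetful functor. -/
def freeModAdj {A : C} (a : MonObj A) : freeMod a ⊣ RightMod.forget a where
  unit :=
    { app X := (ρ_ X).inv ≫ X ◁ MonObj.one
      naturality X Y f := by
        change f ≫ (ρ_ Y).inv ≫ Y ◁ MonObj.one = ((ρ_ X).inv ≫ X ◁ MonObj.one) ≫ f ▷ A
        simp [whisker_exchange] }
  counit :=
    { app P := ⟨P.str.act, by
        change ((α_ P.X A A).hom ≫ P.X ◁ MonObj.mul) ≫ P.str.act = P.str.act ▷ A ≫ P.str.act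
        rw [Category.assoc, P.str.act_mul, Iso.hom_inv_id_assoc]⟩
      naturality P Q f := RightMod.Hom.ext f.comm.symm }
  left_triangle_components X := by
    apply RightMod.Hom.ext
    change ((ρ_ X).inv ≫ X ◁ MonObj.one) ▷ A ≫ (α_ X A A).hom ≫ X ◁ MonObj.mul = 𝟙 (X ⊗ A)
    rw [comp_whiskerRight, Category.assoc, associator_naturality_middle_assoc, ← whiskerLeft_comp,
      MonObj.one_mul]
    simp
  right_triangle_components P := by
    change ((ρ_ P.X).inv ≫ P.X ◁ MonObj.one) ≫ P.str.act = 𝟙 P.X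
    rw [Category.assoc, P.str.act_one, Iso.inv_hom_id]

/-- The forgetful functor from right comodules. -/
@[simps]
def RightComod.forget {A : C} (a : ComonObj A) : RightComod a ⥤ C where
  obj P := P.X
  map f := f.hom
  map_id _ := rfl
  map_comp _ _ := rfl

/-- The cofree comodule functor is right adjoint to the forgetful functor. -/
def cofreeComodAdj {A : C} (a : ComonObj A) : RightComod.forget a ⊣ cofreeComod a where
  unit :=
    { app P := ⟨P.str.coact, by
        change P.str.coact ≫ P.str.coact ▷ A =
          P.str.coact ≫ P.X ◁ ComonObj.comul ≫ (α_ P.X A A).inv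
        rw [reassoc_of% P.str.coact_comul, Iso.hom_inv_id, Category.comp_id]⟩
      naturality P Q f := RightComod.Hom.ext f.comm.symm }
  counit :=
    { app X := X ◁ ComonObj.counit ≫ (ρ_ X).hom
      naturality X Y f := by
        change f ▷ A ≫ Y ◁ ComonObj.counit ≫ (ρ_ Y).hom =
          (X ◁ ComonObj.counit ≫ (ρ_ X).hom) ≫ f
        simp [← whisker_exchange_assoc] }
  left_triangle_components P := by
    change P.str.coact ≫ P.X ◁ ComonObj.counit ≫ (ρ_ P.X).hom = 𝟙 P.X
    rw [reassoc_of% P.str.coact_counit, Iso.inv_hom_id]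
  right_triangle_components X := by
    apply RightComod.Hom.ext
    change (X ◁ ComonObj.comul ≫ (α_ X A A).inv) ≫ (X ◁ ComonObj.counit ≫ (ρ_ X).hom) ▷ A =
      𝟙 (X ⊗ A)
    rw [comp_whiskerRight, Category.assoc, ← associator_inv_naturality_middle_assoc,
      ← whiskerLeft_comp_assoc, ComonObj.counit_comul]
    simp

instance {A : C} (a : ComonObj A) : (RightComod.forget a).ReflectsIsomorphisms where
  reflects {P Q} f hf := by
    have : IsIso f.hom := hf
    refine ⟨⟨inv f.hom, ?_⟩, RightComod.Hom.ext (IsIso.hom_inv_id f.hom),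
      RightComod.Hom.ext (IsIso.inv_hom_id f.hom)⟩
    rw [← cancel_epi f.hom, ← reassoc_of% f.comm, ← comp_whiskerRight, IsIso.hom_inv_id,
      IsIso.hom_inv_id_assoc, id_whiskerRight, Category.comp_id]

/-- The splitting object inherits the action conjugated by `i` and `e`; linearity of `p` makes both
`i` and `e` module morphisms and yields the module laws. -/
instance {A : C} (a : MonObj A) [IsIdempotentComplete C] : IsIdempotentComplete (RightMod a) where
  idempotents_split P p hp := by
    obtain ⟨Y, i, e, hie, hei⟩ :=
      IsIdempotentComplete.idempotents_split P.X p.hom (congrArg RightMod.Hom.hom hp)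
    have hi : (i ▷ A ≫ P.str.act ≫ e) ≫ i = i ▷ A ≫ P.str.act := by
      rw [Category.assoc, Category.assoc, hei, p.comm, ← hei, ← comp_whiskerRight_assoc,
        reassoc_of% hie]
    have he : P.str.act ≫ e = e ▷ A ≫ i ▷ A ≫ P.str.act ≫ e := by
      rw [← comp_whiskerRight_assoc, hei, ← reassoc_of% p.comm, ← hei, Category.assoc, hie,
        Category.comp_id]
    refine ⟨⟨Y, i ▷ A ≫ P.str.act ≫ e, ?_, ?_⟩, ⟨i, hi⟩, ⟨e, he⟩,
      RightMod.Hom.ext hie, RightMod.Hom.ext hei⟩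
    · rw [whisker_exchange_assoc, reassoc_of% P.str.act_one]
      simp [hie]
    · rw [whisker_exchange_assoc, reassoc_of% P.str.act_mul, ← comp_whiskerRight_assoc, hi,
        comp_whiskerRight, Category.assoc, associator_inv_naturality_left_assoc]

end FreeCofree

/-! ### The free Hopf module on an `A`-comodule. -/

namespace Duoidal

variable {M : Type u} [Category.{v} M] [Duoidal M]

namespace HopfModule

variable (A : Bimonoid M)

/-- The functor forgetting the action of a Hopf module. -/
@[simps]
def forgetToComod : HopfModule A ⥤ Comod A where
  obj X := ⟨X.X, X.coaction⟩
  map f := ⟨f.hom, f.comm_coact⟩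
  map_id _ := rfl
  map_comp _ _ := rfl

instance : (forgetToComod A).Faithful where
  map_injective h := HopfModule.Hom.ext (congrArg RightComod.Hom.hom h)

instance : (forgetToComod A).ReflectsIsomorphisms where
  reflects {P Q} f hf := by
    obtain ⟨g, fg, gf⟩ := hf.out
    let k : Q.X ⟶ P.X := g.hom
    have fk : f.hom ≫ k = 𝟙 P.X := congrArg RightComod.Hom.hom fg
    have kf : k ≫ f.hom = 𝟙 Q.X := congrArg RightComod.Hom.hom gf
    have h : (k ⊠ₒ 𝟙 A.X) ≫ (f.hom ⊠ₒ 𝟙 A.X) = 𝟙 _ := by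
      rw [circ_comp, kf, Category.comp_id, circ_id]
    refine ⟨⟨k, ?_, g.comm⟩, HopfModule.Hom.ext fk, HopfModule.Hom.ext kf⟩
    have e := f.comm_act
    rw [circ_right] at e ⊢
    calc Q.action.act ≫ k = (k ⊠ₒ 𝟙 A.X) ≫ ((f.hom ⊠ₒ 𝟙 A.X) ≫ Q.action.act) ≫ k := by
          rw [Category.assoc, reassoc_of% h]
      _ = (k ⊠ₒ 𝟙 A.X) ≫ P.action.act := by
          rw [← e, Category.assoc, fk, Category.comp_id]

end HopfModule

section FreeHopfModule

variable (A : Bimonoid M)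

lemma coact_counit_bul (Q : Comod A) : Q.str.coact ≫ (𝟙 Q.X ⊠ᵦ A.ε) = (rᵦ Q.X).inv := by
  rw [← bul_left]
  exact Q.str.coact_counit

lemma coact_comul_bul (Q : Comod A) : Q.str.coact ≫ (𝟙 Q.X ⊠ᵦ A.Δ) =
    Q.str.coact ≫ (Q.str.coact ⊠ᵦ 𝟙 A.X) ≫ (αᵦ Q.X A.X A.X).hom := by
  rw [← bul_left, ← bul_right]
  exact Q.str.coact_comul

lemma comul_counit_bul : A.Δ ≫ (𝟙 A.X ⊠ᵦ A.ε) = (rᵦ A.X).inv := by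
  rw [← bul_left]
  exact @ComonObj.comul_counit M _ TwoMonoidal.bul A.X A.comon

lemma comul_coassoc_bul : A.Δ ≫ (𝟙 A.X ⊠ᵦ A.Δ) =
    A.Δ ≫ (A.Δ ⊠ᵦ 𝟙 A.X) ≫ (αᵦ A.X A.X A.X).hom := by
  rw [← bul_left, ← bul_right]
  exact @ComonObj.comul_assoc M _ TwoMonoidal.bul A.X A.comon

lemma mul_assoc_circ : (A.μ ⊠ₒ 𝟙 A.X) ≫ A.μ = (αₒ A.X A.X A.X).hom ≫ (𝟙 A.X ⊠ₒ A.μ) ≫ A.μ := by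
  rw [← circ_left, ← circ_right]
  exact @MonObj.mul_assoc M _ TwoMonoidal.circ A.X A.mon

lemma mul_one_circ : (𝟙 A.X ⊠ₒ A.η) ≫ A.μ = (rₒ A.X).hom := by
  rw [← circ_left]
  exact @MonObj.mul_one M _ TwoMonoidal.circ A.X A.mon

/-- The diagonal coaction of `A` on `Q ∘ A`. -/
def diagonalCoact (Q : Comod A) : Q.X ⊗ₒ A.X ⟶ (Q.X ⊗ₒ A.X) ⊗ᵦ A.X :=
  (Q.str.coact ⊠ₒ A.Δ) ≫ ζ Q.X A.X A.X A.X ≫ (𝟙 (Q.X ⊗ₒ A.X) ⊠ᵦ A.μ)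

/-- Multiplicativity of `ε` replaces `μ` by the multiplication of `J`, and the right unit axiom of
`ζ` for `•` absorbs the latter. -/
lemma diagonalCoact_counit (Q : Comod A) :
    diagonalCoact A Q ≫ (Q.X ⊗ₒ A.X) ◁ᵦ A.ε = (rᵦ (Q.X ⊗ₒ A.X)).inv := by
  rw [← cancel_mono (rᵦ (Q.X ⊗ₒ A.X)).hom, Iso.inv_hom_id, diagonalCoact, bul_left]
  simp only [Category.assoc]
  rw [reassoc_of% bul_comp, Category.comp_id, A.mul_counit, ← Category.id_comp (𝟙 (Q.X ⊗ₒ A.X)),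
    ← bul_comp, ← circ_id, Category.assoc, ← reassoc_of% ζ_naturality, reassoc_of% circ_comp,
    coact_counit_bul, comul_counit_bul, circ_id, ← bul_left, ζ_unit_right_bul, circ_comp,
    Iso.inv_hom_id, Iso.inv_hom_id, circ_id]
  exact (Category.comp_id _).symm

/-- Multiplicativity of `Δ` brings in a second `ζ`; the associativity axiom of `ζ` for `•` then
matches coassociativity of `Q` and of `A`. -/
lemma diagonalCoact_comul (Q : Comod A) :
    diagonalCoact A Q ≫ (Q.X ⊗ₒ A.X) ◁ᵦ A.Δ =
      diagonalCoact A Q ≫ diagonalCoact A Q ▷ᵦ A.X ≫ (αᵦ (Q.X ⊗ₒ A.X) A.X A.X).hom := by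
  have key := ζ_assoc_bul Q.X A.X A.X A.X A.X A.X
  simp only [bul_left, bul_right] at key
  have l : diagonalCoact A Q ≫ (𝟙 (Q.X ⊗ₒ A.X) ⊠ᵦ A.Δ) =
      ((Q.str.coact ≫ (𝟙 Q.X ⊠ᵦ A.Δ)) ⊠ₒ (A.Δ ≫ (𝟙 A.X ⊠ᵦ A.Δ))) ≫
        ζ Q.X (A.X ⊗ᵦ A.X) A.X (A.X ⊗ᵦ A.X) ≫ (𝟙 (Q.X ⊗ₒ A.X) ⊠ᵦ ζ A.X A.X A.X A.X) ≫
          (𝟙 (Q.X ⊗ₒ A.X) ⊠ᵦ (A.μ ⊠ᵦ A.μ)) := by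
    rw [← circ_comp, Category.assoc, reassoc_of% ζ_naturality, diagonalCoact]
    simp only [Category.assoc, bul_comp, circ_id, Category.comp_id]
    rw [A.mul_comul]
  have r : diagonalCoact A Q ≫ (diagonalCoact A Q ⊠ᵦ 𝟙 A.X) ≫
        (αᵦ (Q.X ⊗ₒ A.X) A.X A.X).hom =
      ((Q.str.coact ≫ (Q.str.coact ⊠ᵦ 𝟙 A.X)) ⊠ₒ (A.Δ ≫ (A.Δ ⊠ᵦ 𝟙 A.X))) ≫
        ζ (Q.X ⊗ᵦ A.X) A.X (A.X ⊗ᵦ A.X) A.X ≫ (ζ Q.X A.X A.X A.X ⊠ᵦ 𝟙 (A.X ⊗ₒ A.X)) ≫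
          (αᵦ (Q.X ⊗ₒ A.X) (A.X ⊗ₒ A.X) (A.X ⊗ₒ A.X)).hom ≫
            (𝟙 (Q.X ⊗ₒ A.X) ⊠ᵦ (A.μ ⊠ᵦ A.μ)) := by
    rw [← circ_comp, ← bul_assoc, Category.assoc, reassoc_of% ζ_naturality]
    simp only [diagonalCoact, Category.assoc, reassoc_of% bul_comp, circ_id, Category.comp_id,
      Category.id_comp]
  rw [bul_left, bul_right, l, r, coact_comul_bul, comul_coassoc_bul, reassoc_of% key,
    reassoc_of% circ_comp]
  simp only [Category.assoc]

/-- `Q ∘ A` as a comodule. -/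
@[simps]
def diagonalCoaction (Q : Comod A) : Coaction A (Q.X ⊗ₒ A.X) :=
  ⟨diagonalCoact A Q, diagonalCoact_counit A Q, diagonalCoact_comul A Q⟩

/-- The counterpart for `∘`: multiplicativity of `Δ`, the associativity axiom of `ζ` for `∘`, and
associativity of `μ`. -/
lemma diagonalCoact_compat (Q : Comod A) :
    (freeAction A.mon Q.X).act ≫ diagonalCoact A Q =
      (diagonalCoact A Q ⊠ₒ A.Δ) ≫ ζ (Q.X ⊗ₒ A.X) A.X A.X A.X ≫
        ((freeAction A.mon Q.X).act ⊠ᵦ A.μ) := by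
  have key := ζ_assoc_circ Q.X A.X A.X A.X A.X A.X
  simp only [circ_left, circ_right] at key
  have act : (freeAction A.mon Q.X).act = (αₒ Q.X A.X A.X).hom ≫ (𝟙 Q.X ⊠ₒ A.μ) := by
    rw [← circ_left]
    rfl
  have l : (𝟙 Q.X ⊠ₒ A.μ) ≫ diagonalCoact A Q =
      (Q.str.coact ⊠ₒ (A.Δ ⊠ₒ A.Δ)) ≫ (𝟙 (Q.X ⊗ᵦ A.X) ⊠ₒ ζ A.X A.X A.X A.X) ≫
        ζ Q.X A.X (A.X ⊗ₒ A.X) (A.X ⊗ₒ A.X) ≫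
          ((𝟙 Q.X ⊠ₒ A.μ) ⊠ᵦ ((𝟙 A.X ⊠ₒ A.μ) ≫ A.μ)) := by
    rw [← Category.comp_id (𝟙 Q.X ⊠ₒ A.μ), ← bul_comp, Category.comp_id,
      ← reassoc_of% ζ_naturality, diagonalCoact]
    simp only [reassoc_of% circ_comp, bul_id, Category.comp_id, Category.id_comp]
    rw [A.mul_comul]
  have r : (diagonalCoact A Q ⊠ₒ A.Δ) ≫ ζ (Q.X ⊗ₒ A.X) A.X A.X A.X ≫
        (((αₒ Q.X A.X A.X).hom ≫ (𝟙 Q.X ⊠ₒ A.μ)) ⊠ᵦ A.μ) =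
      ((Q.str.coact ⊠ₒ A.Δ) ⊠ₒ A.Δ) ≫ (ζ Q.X A.X A.X A.X ⊠ₒ 𝟙 (A.X ⊗ᵦ A.X)) ≫
        ζ (Q.X ⊗ₒ A.X) (A.X ⊗ₒ A.X) A.X A.X ≫
          (((αₒ Q.X A.X A.X).hom ≫ (𝟙 Q.X ⊠ₒ A.μ)) ⊠ᵦ ((A.μ ⊠ₒ 𝟙 A.X) ≫ A.μ)) := by
    have nat := ζ_naturality (𝟙 (Q.X ⊗ₒ A.X)) A.μ (𝟙 A.X) (𝟙 A.X)
    rw [circ_id, bul_id] at nat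
    rw [← Category.id_comp ((αₒ Q.X A.X A.X).hom ≫ (𝟙 Q.X ⊠ₒ A.μ)), ← bul_comp,
      ← reassoc_of% nat, Category.id_comp, diagonalCoact]
    simp only [reassoc_of% circ_comp, Category.comp_id]
  rw [act, r, mul_assoc_circ, ← bul_comp, reassoc_of% key, Category.assoc, l,
    reassoc_of% circ_assoc]

/-- The free Hopf module functor `Q ↦ Q ∘ A` on `A`-comodules. -/
@[simps]
def freeHopfModule : Comod A ⥤ HopfModule A where
  obj Q :=
    { X := Q.X ⊗ₒ A.X
      action := freeAction A.mon Q.X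
      coaction := diagonalCoaction A Q
      compat := diagonalCoact_compat A Q }
  map {P Q} f := ⟨f.hom ▷ₒ A.X, ((freeMod A.mon).map f.hom).comm, by
    have h : P.str.coact ≫ (f.hom ⊠ᵦ 𝟙 A.X) = f.hom ≫ Q.str.coact := by
      rw [← bul_right]
      exact f.comm
    simp only [diagonalCoaction_coact, diagonalCoact, circ_right, bul_right, Category.assoc,
      bul_comp, Category.id_comp, Category.comp_id]
    rw [reassoc_of% circ_comp, ← h, Category.id_comp, ← Category.comp_id A.Δ, ← circ_comp,
      ← bul_id, Category.assoc, reassoc_of% ζ_naturality, bul_comp, circ_id, Category.id_comp,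
      Category.comp_id, bul_id, Category.comp_id]⟩
  map_id _ := HopfModule.Hom.ext (@MonoidalCategory.id_whiskerRight M _ TwoMonoidal.circ _ _)
  map_comp _ _ :=
    HopfModule.Hom.ext (@MonoidalCategory.comp_whiskerRight M _ TwoMonoidal.circ _ _ _ _ _ _)

/-- Makes the unit of the free module adjunction colinear. It rests on the compatibility of `Δ` with
`η` and the right unit axiom of `ζ` for `∘`. -/
lemma freeUnit_coact (Q : Comod A) :
    Q.str.coact ≫ (((rₒ Q.X).inv ≫ (Q.X ◁ₒ A.η)) ▷ᵦ A.X) =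
      ((rₒ Q.X).inv ≫ (Q.X ◁ₒ A.η)) ≫ diagonalCoact A Q := by
  have nat : (rₒ Q.X).inv ≫ (Q.str.coact ⊠ₒ 𝟙 (unitI M)) =
      Q.str.coact ≫ (rₒ (Q.X ⊗ᵦ A.X)).inv := by
    rw [← circ_right]
    exact (@MonoidalCategory.rightUnitor_inv_naturality M _ TwoMonoidal.circ _ _ _).symm
  have h : (Q.X ◁ₒ A.η) ≫ diagonalCoact A Q =
      (Q.str.coact ⊠ₒ 𝟙 (unitI M)) ≫ (rₒ (Q.X ⊗ᵦ A.X)).hom ≫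
        (((rₒ Q.X).inv ≫ (𝟙 Q.X ⊠ₒ A.η)) ⊠ᵦ 𝟙 A.X) := by
    rw [← ζ_unit_right_circ]
    simp only [Category.assoc, bul_comp, Iso.hom_inv_id_assoc, Category.comp_id, circ_left,
      diagonalCoact]
    rw [reassoc_of% circ_comp, reassoc_of% circ_comp, Category.id_comp, Category.comp_id,
      Category.id_comp, A.one_comul, ← mul_one_circ, ← Category.comp_id (𝟙 Q.X ⊠ₒ A.η), ← bul_comp,
      ← reassoc_of% ζ_naturality, reassoc_of% circ_comp, bul_id, Category.comp_id]
  rw [Category.assoc, h, reassoc_of% nat, Iso.inv_hom_id_assoc, bul_right, circ_left]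

/-- The free Hopf module functor is left adjoint to the forgetful functor. -/
def freeHopfModuleAdj : freeHopfModule A ⊣ HopfModule.forgetToComod A where
  unit :=
    { app Q := ⟨(rₒ Q.X).inv ≫ (Q.X ◁ₒ A.η), freeUnit_coact A Q⟩
      naturality P Q f := RightComod.Hom.ext ((freeModAdj A.mon).unit.naturality f.hom) }
  counit :=
    { app X := ⟨X.action.act, ((freeModAdj A.mon).counit.app ⟨X.X, X.action⟩).comm, by
        -- Colinearity of the action is exactly the Hopf module condition.
        change diagonalCoact A ⟨X.X, X.coaction⟩ ≫ X.action.act ▷ᵦ A.X =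
          X.action.act ≫ X.coaction.coact
        rw [X.compat, diagonalCoact, bul_right, Category.assoc, Category.assoc, bul_comp,
          Category.id_comp, Category.comp_id]⟩
      naturality P Q f := HopfModule.Hom.ext f.comm_act.symm }
  left_triangle_components Q := HopfModule.Hom.ext
    (congrArg RightMod.Hom.hom ((freeModAdj A.mon).left_triangle_components Q.X))
  right_triangle_components X := RightComod.Hom.ext
    ((freeModAdj A.mon).right_triangle_components ⟨X.X, X.action⟩)

end FreeHopfModule

end Duoidal

/-! ### Identification of `ς` and descent of morphisms along `(-) • A`. -/

namespace Duoidal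

variable {M : Type u} [Category.{v} M] [Duoidal M] (A : Bimonoid M)

/-- The functor `Q ↦ Q ∘ J` from `A`-comodules to `J`-modules is left adjoint to `P ↦ P • A`. -/
def comparisonAdj : RightComod.forget A.comon ⋙ freeMod (monJ (M := M)) ⊣
    comparison A ⋙ HopfModule.forgetToComod A :=
  -- The coaction on `P • A` is the cofree one, so the composite right adjoint agrees definitionally
  -- with the stated one.
  (cofreeComodAdj A.comon).comp (freeModAdj (monJ (M := M)))

lemma comparisonAdj_unit (Q : Comod A) : ((comparisonAdj A).unit.app Q).hom =
    Q.str.coact ≫ ((rₒ Q.X).inv ≫ Q.X ◁ₒ CircMon.one (monJ (M := M))) ▷ᵦ A.X := by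
  have h := (cofreeComodAdj A.comon).comp_unit_app (freeModAdj (monJ (M := M))) Q
  exact congrArg RightComod.Hom.hom h

/-- The transpose of the unit is the unit, tensored with `A`, followed by the action on `(Q ∘ J) •
A`. That action multiplies in `J`, and this cancels the unit of `J` just inserted. -/
lemma leftAdjointComparison_hom (Q : Comod A) :
    (leftAdjointComparison (freeHopfModuleAdj A) (comparisonAdj A) Q).hom = ς A Q := by
  let L : ModJ M := (freeMod (monJ (M := M))).obj Q.X
  let u : Q.X ⟶ Q.X ⊗ₒ unitJ M := (rₒ Q.X).inv ≫ Q.X ◁ₒ CircMon.one (monJ (M := M))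
  let a : (Q.X ⊗ₒ unitJ M) ⊗ₒ unitJ M ⟶ Q.X ⊗ₒ unitJ M := L.str.act
  have hu : (u ⊠ₒ 𝟙 (unitJ M)) ≫ a = 𝟙 _ := by
    rw [← circ_right]
    exact congrArg RightMod.Hom.hom
      ((freeModAdj (monJ (M := M))).left_triangle_components Q.X)
  have h : (leftAdjointComparison (freeHopfModuleAdj A) (comparisonAdj A) Q).hom =
      ((comparisonAdj A).unit.app Q).hom ▷ₒ A.X ≫ comparisonAct A L := by
    rw [leftAdjointComparison, Adjunction.homEquiv_counit]
    rfl
  rw [h, comparisonAdj_unit]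
  change (Q.str.coact ≫ u ▷ᵦ A.X) ▷ₒ A.X ≫ ((Q.X ⊗ₒ unitJ M) ⊗ᵦ A.X) ◁ₒ (lᵦ A.X).inv ≫
    ζ (Q.X ⊗ₒ unitJ M) A.X (unitJ M) A.X ≫ (a ⊠ᵦ A.μ) = ς A Q
  have e : (Q.str.coact ≫ (u ⊠ᵦ 𝟙 A.X)) ⊠ₒ (lᵦ A.X).inv =
      (Q.str.coact ⊠ₒ (lᵦ A.X).inv) ≫ ((u ⊠ᵦ 𝟙 A.X) ⊠ₒ (𝟙 (unitJ M) ⊠ᵦ 𝟙 A.X)) := by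
    rw [circ_comp, bul_id, Category.comp_id]
  rw [ς, bul_right, bul_left, circ_right, circ_right, circ_left, circ_left,
    reassoc_of% circ_comp, reassoc_of% circ_comp, Category.id_comp, Category.comp_id,
    Category.comp_id, e, Category.assoc, reassoc_of% ζ_naturality, bul_comp,
    hu, circ_id, Category.id_comp]

section Restrict

variable [(functorG M).Full]

/-- The morphism `P ⟶ Q` of `J`-modules corresponding to a morphism `P • I ⟶ Q`, when `functorG`
is full. -/
noncomputable def liftModJ {P Q : ModJ M} (m : P.X ⊗ᵦ unitI M ⟶ Q.X) : P ⟶ Q :=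
  (functorG M).preimage ((cofreeComodAdj (comonI (M := M))).homEquiv ((functorG M).obj P) Q.X m)

lemma functorG_map_liftModJ {P Q : ModJ M} (m : P.X ⊗ᵦ unitI M ⟶ Q.X) :
    (functorG M).map (liftModJ m) =
      (cofreeComodAdj (comonI (M := M))).homEquiv ((functorG M).obj P) Q.X m :=
  (functorG M).map_preimage _

variable [(functorG M).Faithful]

lemma liftModJ_comp_left {P Q R : ModJ M} (f : P ⟶ Q) (m : Q.X ⊗ᵦ unitI M ⟶ R.X) :
    liftModJ (P := P) (Q := R) (f.hom ▷ᵦ unitI M ≫ m) = f ≫ liftModJ m := by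
  apply (functorG M).map_injective
  rw [functorG_map_liftModJ, (functorG M).map_comp, functorG_map_liftModJ]
  exact (cofreeComodAdj (comonI (M := M))).homEquiv_naturality_left ((functorG M).map f) m

lemma liftModJ_comp_right {P Q R : ModJ M} (m : P.X ⊗ᵦ unitI M ⟶ Q.X) (f : Q ⟶ R) :
    liftModJ (P := P) (Q := R) (m ≫ f.hom) = liftModJ m ≫ f := by
  apply (functorG M).map_injective
  rw [functorG_map_liftModJ, (functorG M).map_comp, functorG_map_liftModJ]
  exact (cofreeComodAdj (comonI (M := M))).homEquiv_naturality_right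
    (X := (functorG M).obj P) m f.hom

/-- Since `τ` is the counit of the comonoid `I`, the given morphism is the counit of the cofree
adjunction, whose transpose is the identity. -/
lemma liftModJ_counit (P : ModJ M) :
    liftModJ (P := P) (Q := P) (P.X ◁ᵦ τ M ≫ (rᵦ P.X).hom) = 𝟙 P := by
  apply (functorG M).map_injective
  rw [functorG_map_liftModJ, (functorG M).map_id]
  exact (Equiv.eq_symm_apply _).1
    ((cofreeComodAdj (comonI (M := M))).homEquiv_symm_id P.X).symm

/-- The morphism `P ⟶ Q` of `J`-modules obtained from a morphism `P • A ⟶ Q • A` by composing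
with the unit and the counit of `A`. -/
noncomputable def restrictModJ {P Q : ModJ M} (t : P.X ⊗ᵦ A.X ⟶ Q.X ⊗ᵦ A.X) : P ⟶ Q :=
  liftModJ (P.X ◁ᵦ A.η ≫ t ≫ Q.X ◁ᵦ A.ε ≫ (rᵦ Q.X).hom)

lemma restrictModJ_comp_left {P Q R : ModJ M} (f : P ⟶ Q) (t : Q.X ⊗ᵦ A.X ⟶ R.X ⊗ᵦ A.X) :
    restrictModJ A (P := P) (Q := R) (f.hom ▷ᵦ A.X ≫ t) = f ≫ restrictModJ A t := by
  rw [restrictModJ, restrictModJ, ← liftModJ_comp_left, Category.assoc,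
    @MonoidalCategory.whisker_exchange_assoc M _ TwoMonoidal.bul]

lemma restrictModJ_comp_right {P Q R : ModJ M} (t : P.X ⊗ᵦ A.X ⟶ Q.X ⊗ᵦ A.X) (f : Q ⟶ R) :
    restrictModJ A (P := P) (Q := R) (t ≫ f.hom ▷ᵦ A.X) = restrictModJ A t ≫ f := by
  have nat : f.hom ▷ᵦ A.X ≫ R.X ◁ᵦ A.ε ≫ (rᵦ R.X).hom =
      Q.X ◁ᵦ A.ε ≫ (rᵦ Q.X).hom ≫ f.hom := by
    rw [← @MonoidalCategory.rightUnitor_naturality M _ TwoMonoidal.bul,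
      @MonoidalCategory.whisker_exchange_assoc M _ TwoMonoidal.bul]
  rw [restrictModJ, restrictModJ, ← liftModJ_comp_right]
  simp only [Category.assoc, nat]

/-- Here the axiom that `ε` after `η` is `τ` reduces the claim to `liftModJ_counit`. -/
lemma restrictModJ_id (P : ModJ M) :
    restrictModJ A (P := P) (Q := P) (𝟙 (P.X ⊗ᵦ A.X)) = 𝟙 P := by
  rw [restrictModJ, ← liftModJ_counit, Category.id_comp, bul_left, bul_left, bul_left,
    reassoc_of% bul_comp, Category.id_comp, A.one_counit]

/-- The retraction `restrictModJ` of the functor `P ↦ P • A` on morphisms. -/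
noncomputable def comparisonHomRetraction :
    HomRetraction (comparison A ⋙ HopfModule.forgetToComod A) where
  toFun t := restrictModJ A t.hom
  map_comp f t := restrictModJ_comp_left A f t.hom
  comp_map t f := restrictModJ_comp_right A t.hom f
  map_id P := restrictModJ_id A P

end Restrict

lemma isIso_ς_iff (Q : Comod A) : IsIso (ς A Q) ↔
    IsIso (leftAdjointComparison (freeHopfModuleAdj A) (comparisonAdj A) Q) := by
  rw [← leftAdjointComparison_hom]
  exact isIso_iff_of_reflects_iso (leftAdjointComparison (freeHopfModuleAdj A) (comparisonAdj A) Q)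
    (HopfModule.forgetToComod A ⋙ RightComod.forget A.comon)

end Duoidal

theorem theorem3p14 {M : Type u} [Category.{v} M] [Duoidal M] [IsIdempotentComplete M]
    [(Duoidal.functorG M).Full] [(Duoidal.functorG M).Faithful] (A : Duoidal.Bimonoid M) :
    (∀ Q : Duoidal.Comod A, IsIso (Duoidal.ς A Q)) ↔ (Duoidal.comparison A).IsEquivalence := by
  refine ⟨fun h => ?_, fun h Q => ?_⟩
  · have (Q : Duoidal.Comod A) : IsIso (leftAdjointComparison (Duoidal.freeHopfModuleAdj A)
        (Duoidal.comparisonAdj A) Q) := (Duoidal.isIso_ς_iff A Q).1 (h Q)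
    exact isEquivalence_of_homRetraction (Duoidal.freeHopfModuleAdj A) (Duoidal.comparisonAdj A)
      (Duoidal.comparisonHomRetraction A)
  · rw [Duoidal.isIso_ς_iff]
    exact isIso_leftAdjointComparison _ _ Q
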